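/- Let $\ell$ be an odd prime. In $\mathrm{GL}_2(\mathbb{F}_\ell)$ let $\mathcal{C}_s$ be the group of invertible diagonal matrices, $\mathcal{C}_s^+ = \mathcal{C}_s \cup \begin{pmatrix} 0 & 1 \\ 1 & 0 \end{pmatrix}\mathcal{C}_s$, $\mathcal{C}_{ns} = \left\{\begin{pmatrix} a & \varepsilon b \\ b & a \end{pmatrix} : a, b \in \mathbb{F}_\ell,\ (a,b) \neq (0,0)\right\}$ for a fixed non-square $\varepsilon \in \mathbb{F}_\ell^\times$ (arbitrarily chosen), and $\mathcal{B}$ the group of invertible upper triangular matrices. For a subgroup $G \subseteq \mathrm{GL}_2(\mathbb{F}_\ell)$, let $\overline{G}$ be its image in $\mathrm{PGL}_2(\mathbb{F}_\ell)$, and let $$\mathcal{F}_1(G) = \frac{\left|\{\gamma \in G : 1 \text{ is an eigenvalue of } \gamma\}\right|}{|G|}.$$ We say that $G$ is - of type $Cs$ if $\ell \nmid |G|$ and $G$ is conjugate in $\mathrm{GL}_2(\mathbb{F}_\ell)$ to a subgroup of $\mathcal{C}_s$; - of type $Ns$ if $\ell \nmid |G|$ and $G$ is conjugate to a subgroup of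 $\mathcal{C}_s^+$, but not to a subgroup of $\mathcal{C}_s$ or of $\mathcal{C}_{ns}$; - of type $B$ if $\ell \mid |G|$ and $G$ is conjugate to a subgroup of $\mathcal{B}$, but not to a subgroup of $\mathcal{C}_s$; - of type $A_4$, $S_4$ or $A_5$ if $\ell \nmid |G|$ and $\overline{G}$ is isomorphic to the alternating group $A_4$, the symmetric group $S_4$ or the alternating group $A_5$, respectively. Let $G \subseteq \mathrm{GL}_2(\mathbb{F}_\ell)$ be a subgroup with $\mathcal{F}_1(G) \neq 1$. Then $$\mathcal{F}_1(G) \leq \begin{cases} \frac12 + \frac{1}{|G|} & \text{if } G \text{ is of type } Cs \text{ or } Ns, \\ \frac12 + \frac{\ell}{|G|} & \text{if } G \text{ is of type } B, \\ \frac34 & \text{if } G \text{ is of type } A_4,\ S_4 \text{ or } A_5. \end{cases}$$ Moreover, for every subgroup $G \subseteq \mathrm{GL}_2(\mathbb{F}_\ell)$, of any of these types or of none, $\mathcal{F}_1(G) \neq 1$ implies $\mathcal{F}_1(G) \leq \frac34$. -/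

import Mathlib

namespace EigOne

open Matrix

/-- The group `GL₂(𝔽_ℓ)`. -/
abbrev GL2 (ℓ : ℕ) : Type := GL (Fin 2) (ZMod ℓ)

/-- The split Cartan subgroup: the invertible diagonal matrices. -/
def splitCartan (ℓ : ℕ) : Subgroup (GL2 ℓ) where
  carrier := {g | ∃ a d : ZMod ℓ, (g : Matrix (Fin 2) (Fin 2) (ZMod ℓ)) = !![a, 0; 0, d]}
  mul_mem' := by
    rintro x y ⟨a, d, hx⟩ ⟨a', d', hy⟩
    exact ⟨a * a', d * d', by simp [hx, hy]⟩
  one_mem' := ⟨1, 1, by simp [Matrix.one_fin_two]⟩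
  inv_mem' := by
    rintro x ⟨a, d, hx⟩
    refine ⟨Ring.inverse x.1.det * d, Ring.inverse x.1.det * a, ?_⟩
    rw [Matrix.coe_units_inv, Matrix.inv_def, hx, Matrix.adjugate_fin_two_of]
    simp

/-- The normalizer of the split Cartan subgroup: the invertible matrices that are diagonal or
antidiagonal, i.e. the union of the split Cartan subgroup and of its coset of
`!![0, 1; 1, 0]`. -/
def splitCartanNormalizer (ℓ : ℕ) : Subgroup (GL2 ℓ) where
  carrier := {g | (∃ a d : ZMod ℓ, (g : Matrix (Fin 2) (Fin 2) (ZMod ℓ)) = !![a, 0; 0, d]) ∨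
    ∃ b c : ZMod ℓ, (g : Matrix (Fin 2) (Fin 2) (ZMod ℓ)) = !![0, b; c, 0]}
  mul_mem' := by
    rintro x y (⟨a, d, hx⟩ | ⟨a, d, hx⟩) (⟨a', d', hy⟩ | ⟨a', d', hy⟩)
    · exact Or.inl ⟨a * a', d * d', by simp [hx, hy]⟩
    · exact Or.inr ⟨a * a', d * d', by simp [hx, hy]⟩
    · exact Or.inr ⟨a * d', d * a', by simp [hx, hy]⟩
    · exact Or.inl ⟨a * d', d * a', by simp [hx, hy]⟩
  one_mem' := Or.inl ⟨1, 1, by simp [Matrix.one_fin_two]⟩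
  inv_mem' := by
    rintro x (⟨a, d, hx⟩ | ⟨b, c, hx⟩)
    · refine Or.inl ⟨Ring.inverse x.1.det * d, Ring.inverse x.1.det * a, ?_⟩
      rw [Matrix.coe_units_inv, Matrix.inv_def, hx, Matrix.adjugate_fin_two_of]
      simp
    · refine Or.inr ⟨Ring.inverse x.1.det * (-b), Ring.inverse x.1.det * (-c), ?_⟩
      rw [Matrix.coe_units_inv, Matrix.inv_def, hx, Matrix.adjugate_fin_two_of]
      simp

/-- The non-split Cartan subgroup attached to `ε`, to be used for a non-square `ε`: the invertible
matrices of the form `!![a, ε * b; b, a]`. -/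
def nonsplitCartan (ℓ : ℕ) (ε : ZMod ℓ) : Subgroup (GL2 ℓ) where
  carrier := {g | ∃ a b : ZMod ℓ, (g : Matrix (Fin 2) (Fin 2) (ZMod ℓ)) = !![a, ε * b; b, a]}
  mul_mem' := by
    rintro x y ⟨a, b, hx⟩ ⟨a', b', hy⟩
    refine ⟨a * a' + ε * b * b', b * a' + a * b', ?_⟩
    rw [Units.val_mul, hx, hy, Matrix.mul_fin_two]
    congr! 3 <;> ring_nf
  one_mem' := ⟨1, 0, by simp [Matrix.one_fin_two]⟩
  inv_mem' := by
    rintro x ⟨a, b, hx⟩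
    refine ⟨Ring.inverse x.1.det * a, Ring.inverse x.1.det * (-b), ?_⟩
    rw [Matrix.coe_units_inv, Matrix.inv_def, hx, Matrix.adjugate_fin_two_of]
    simp [mul_left_comm]

/-- The Borel subgroup: the invertible upper triangular matrices. -/
def borel (ℓ : ℕ) : Subgroup (GL2 ℓ) where
  carrier := {g | ∃ a b d : ZMod ℓ, (g : Matrix (Fin 2) (Fin 2) (ZMod ℓ)) = !![a, b; 0, d]}
  mul_mem' := by
    rintro x y ⟨a, b, d, hx⟩ ⟨a', b', d', hy⟩
    exact ⟨a * a', a * b' + b * d', d * d', by simp [hx, hy]⟩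
  one_mem' := ⟨1, 0, 1, by simp [Matrix.one_fin_two]⟩
  inv_mem' := by
    rintro x ⟨a, b, d, hx⟩
    refine ⟨Ring.inverse x.1.det * d, Ring.inverse x.1.det * (-b), Ring.inverse x.1.det * a, ?_⟩
    rw [Matrix.coe_units_inv, Matrix.inv_def, hx, Matrix.adjugate_fin_two_of]
    simp

/-- `G` is conjugate to a subgroup of `H`. -/
def ConjInto {ℓ : ℕ} (G H : Subgroup (GL2 ℓ)) : Prop :=
  ∃ g : GL2 ℓ, G.map (MulAut.conj g).toMonoidHom ≤ H

/-- The image of `G` in `PGL₂(𝔽_ℓ)`, the quotient of `GL₂(𝔽_ℓ)` by its center. -/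
def projImage {ℓ : ℕ} (G : Subgroup (GL2 ℓ)) :
    Subgroup (ProjGenLinGroup (Fin 2) (ZMod ℓ)) :=
  G.map ProjGenLinGroup.mk

/-- Type `Cs`. -/
def IsTypeCs {ℓ : ℕ} (G : Subgroup (GL2 ℓ)) : Prop :=
  ¬ ℓ ∣ Nat.card G ∧ ConjInto G (splitCartan ℓ)

/-- Type `Ns`, with respect to a non-square `ε`. -/
def IsTypeNs {ℓ : ℕ} (ε : ZMod ℓ) (G : Subgroup (GL2 ℓ)) : Prop :=
  ¬ ℓ ∣ Nat.card G ∧ ConjInto G (splitCartanNormalizer ℓ) ∧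
    ¬ ConjInto G (splitCartan ℓ) ∧ ¬ ConjInto G (nonsplitCartan ℓ ε)

/-- Type `B`. -/
def IsTypeB {ℓ : ℕ} (G : Subgroup (GL2 ℓ)) : Prop :=
  ℓ ∣ Nat.card G ∧ ConjInto G (borel ℓ) ∧ ¬ ConjInto G (splitCartan ℓ)

/-- Type `A₄`. -/
def IsTypeA4 {ℓ : ℕ} (G : Subgroup (GL2 ℓ)) : Prop :=
  ¬ ℓ ∣ Nat.card G ∧ Nonempty (projImage G ≃* alternatingGroup (Fin 4))

/-- Type `S₄`. -/
def IsTypeS4 {ℓ : ℕ} (G : Subgroup (GL2 ℓ)) : Prop :=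
  ¬ ℓ ∣ Nat.card G ∧ Nonempty (projImage G ≃* Equiv.Perm (Fin 4))

/-- Type `A₅`. -/
def IsTypeA5 {ℓ : ℕ} (G : Subgroup (GL2 ℓ)) : Prop :=
  ¬ ℓ ∣ Nat.card G ∧ Nonempty (projImage G ≃* alternatingGroup (Fin 5))

/-- The set of matrices in `GL₂(𝔽_ℓ)` that have `1` as an eigenvalue. -/
def eigOneSet (ℓ : ℕ) : Set (GL2 ℓ) :=
  {γ | Module.End.HasEigenvalue
    (Matrix.toLin' (γ : Matrix (Fin 2) (Fin 2) (ZMod ℓ))) (1 : ZMod ℓ)}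

/-- The proportion of elements of `G` that have `1` as an eigenvalue. -/
noncomputable def F1 {ℓ : ℕ} (G : Subgroup (GL2 ℓ)) : ℚ :=
  (Nat.card ((G : Set (GL2 ℓ)) ∩ eigOneSet ℓ : Set (GL2 ℓ)) : ℚ) / (Nat.card G : ℚ)

end EigOne

/-!
If `G` fixes a line `K v`, an element `g` of `G` has eigenvalue `1` exactly when `g v = v` or
`g v = det g • v`. So the elements with eigenvalue `1` form a union of two subgroups, which must be
proper, and a union of two proper subgroups `A` and `D` of `G` has at most `3/4 |G|` and at most
`1/2 |G| + |A ⊓ D|` elements. Here `A ⊓ D` is a group of transvections along `v`, embedded in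
the additive group of `K`, and trivial when `G` fixes a second line.

If `G` permutes two lines without fixing them, let `H` be the subgroup of index two fixing both. An
element of `G` outside `H` has trace `0`, so if it has eigenvalue `1` its determinant is `-1`, and
the product of two such elements is in `H ∩ SL₂`. Hence there are at most `|H ∩ SL₂|` of them. In
`H`, only the identity has both eigenvalue `1` and determinant `1`, which leaves at most
`|H| + 1 - |H ∩ SL₂|` elements with eigenvalue `1`.

For the bound `3/4` in general, recall that `1` is an eigenvalue of `g` if and only if
`tr g = 1 + det g`, and let `S = G ∩ SL₂`.
* If `S` is trivial, `G` is abelian and fixes the line fixed pointwise by any element other than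
  the identity that has eigenvalue `1`.
* If `S` contains a transvection `u` along `v`, then `x` and `x u` both have eigenvalue `1` only
  if `tr (x u) = tr x`, which by Cayley–Hamilton forces `x` to fix the line `K v`.
* Otherwise take `h ≠ 1` in `S`. The identity `tr (x h) + tr (x h⁻¹) = tr x tr h` shows that `x`,
  `x h` and `x h⁻¹` cannot all have eigenvalue `1` unless `det x = -1`. So at most two thirds of the
  elements of determinant other than `±1` have eigenvalue `1`, while only one element of `S` does.
-/

namespace EigOne

open Matrix
open scoped LinearAlgebra.Projectivization

section Counting

variable {α : Type*}

theorem ncard_add_ncard_le {S T K : Set α} (hK : K.Finite) (hS : S ⊆ K) (hT : T ⊆ K) :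
    S.ncard + T.ncard ≤ K.ncard + (S ∩ T).ncard := by
  rw [← Set.ncard_union_add_ncard_inter S T (hK.subset hS) (hK.subset hT)]
  gcongr
  exact Set.union_subset hS hT

theorem ncard_add_ncard_add_ncard_le {S T U K : Set α} (hK : K.Finite) (hS : S ⊆ K) (hT : T ⊆ K)
    (hU : U ⊆ K) (h : S ∩ T ∩ U = ∅) : S.ncard + T.ncard + U.ncard ≤ 2 * K.ncard := by
  have h₁ := ncard_add_ncard_le hK hS hT
  have h₂ := ncard_add_ncard_le hK (Set.inter_subset_left.trans hS : S ∩ T ⊆ K) hU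
  rw [h, Set.ncard_empty] at h₂
  omega

theorem ncard_eq_inter_add_inter_add_sdiff {X : Set α} (hX : X.Finite) (S D : Set α) :
    X.ncard = (X ∩ S).ncard + ((X \ S) ∩ D).ncard + ((X \ S) \ D).ncard := by
  rw [add_assoc, Set.ncard_inter_add_ncard_sdiff_eq_ncard (X \ S) D hX.sdiff,
    Set.ncard_inter_add_ncard_sdiff_eq_ncard X S hX]

variable {Γ : Type*} [Group Γ]

theorem two_mul_card_le_of_lt {H K : Subgroup Γ} [Finite K] (h : H < K) :
    2 * Nat.card H ≤ Nat.card K := by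
  obtain ⟨m, hm⟩ := Subgroup.card_dvd_of_le h.le
  have hm₀ : m ≠ 0 := by
    rintro rfl
    exact Nat.card_pos.ne' hm
  have hm₁ : m ≠ 1 := by
    rintro rfl
    exact h.ne (Subgroup.eq_of_le_of_card_ge h.le (by rw [hm, mul_one]))
  rw [hm, mul_comm]
  gcongr
  omega

theorem card_mul_relIndex {H K : Subgroup Γ} (h : H ≤ K) :
    Nat.card H * H.relIndex K = Nat.card K := by
  rw [← Subgroup.relIndex_bot_left, ← Subgroup.relIndex_bot_left]
  exact Subgroup.relIndex_mul_relIndex _ _ _ bot_le h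

theorem card_mul_card_le {A D K : Subgroup Γ} [Finite K] (hA : A ≤ K) (hD : D ≤ K) :
    Nat.card A * Nat.card D ≤ Nat.card K * Nat.card (A ⊓ D : Subgroup Γ) := by
  have hcard : Nat.card D * D.relIndex K = Nat.card K := card_mul_relIndex hD
  have hindex : D.relIndex A ≤ D.relIndex K :=
    Subgroup.relIndex_le_of_le_right hA (right_ne_zero_of_mul (hcard ▸ Nat.card_pos.ne'))
  calc Nat.card A * Nat.card D
      = Nat.card (A ⊓ D : Subgroup Γ) * D.relIndex A * Nat.card D := by
        rw [← Subgroup.inf_relIndex_left, card_mul_relIndex inf_le_left]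
    _ ≤ Nat.card (A ⊓ D : Subgroup Γ) * D.relIndex K * Nat.card D := by gcongr
    _ = Nat.card K * Nat.card (A ⊓ D : Subgroup Γ) := by
        rw [← hcard]
        ring

theorem ncard_union_add_card_inf {A D K : Subgroup Γ} [Finite K] (hA : A ≤ K) (hD : D ≤ K) :
    (A ∪ D : Set Γ).ncard + Nat.card (A ⊓ D : Subgroup Γ) = Nat.card A + Nat.card D :=
  Set.ncard_union_add_ncard_inter (A : Set Γ) D ((Set.toFinite (K : Set Γ)).subset hA)
    ((Set.toFinite (K : Set Γ)).subset hD)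

theorem four_mul_ncard_union_le {A D K : Subgroup Γ} [Finite K] (hA : A < K) (hD : D < K) :
    4 * (A ∪ D : Set Γ).ncard ≤ 3 * Nat.card K := by
  have hunion := ncard_union_add_card_inf hA.le hD.le
  have hprod := card_mul_card_le hA.le hD.le
  have hA₂ := two_mul_card_le_of_lt hA
  have hD₂ := two_mul_card_le_of_lt hD
  have hK : 0 < Nat.card K := Nat.card_pos
  zify at *
  refine le_of_mul_le_mul_left ?_ hK
  nlinarith [mul_nonneg (sub_nonneg.2 hA₂) (sub_nonneg.2 hD₂)]

theorem two_mul_ncard_union_le {A D K : Subgroup Γ} [Finite K] (hA : A < K) (hD : D < K) :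
    2 * (A ∪ D : Set Γ).ncard ≤ Nat.card K + 2 * Nat.card (A ⊓ D : Subgroup Γ) := by
  have hunion := ncard_union_add_card_inf hA.le hD.le
  have hA₂ := two_mul_card_le_of_lt hA
  have hD₂ := two_mul_card_le_of_lt hD
  by_cases hAD : A ≤ D
  · rw [inf_eq_left.2 hAD] at hunion ⊢
    omega
  by_cases hDA : D ≤ A
  · rw [inf_eq_right.2 hDA] at hunion ⊢
    omega
  have : Finite A := Set.Finite.subset (Set.toFinite (K : Set Γ)) hA.le
  have : Finite D := Set.Finite.subset (Set.toFinite (K : Set Γ)) hD.le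
  have : Finite (A ⊓ D : Subgroup Γ) := Set.Finite.subset (Set.toFinite (A : Set Γ)) inf_le_left
  have hprod := card_mul_card_le hA.le hD.le
  have hinfA := two_mul_card_le_of_lt (inf_lt_left.2 hAD)
  have hinfD := two_mul_card_le_of_lt (inf_lt_right.2 hDA)
  have hinf : 0 < Nat.card (A ⊓ D : Subgroup Γ) := Nat.card_pos
  zify at *
  refine le_of_mul_le_mul_left ?_ hinf
  nlinarith [mul_nonneg (sub_nonneg.2 hinfA) (sub_nonneg.2 hinfD)]

theorem ncard_le_card_of_mul_mem {T : Set Γ} {S : Subgroup Γ} [Finite S]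
    (h : ∀ x ∈ T, ∀ y ∈ T, x * y ∈ S) : T.ncard ≤ Nat.card S := by
  obtain rfl | ⟨x, hx⟩ := T.eq_empty_or_nonempty
  · simp
  · exact Set.ncard_le_ncard_of_injOn (x * ·) (h x hx) (mul_right_injective x).injOn
      (Set.toFinite (S : Set Γ))

theorem three_mul_ncard_le_two_mul_ncard {A W : Set Γ} (hW : W.Finite) (hA : A ⊆ W) (h : Γ)
    (hmul : ∀ x ∈ W, x * h ∈ W) (hinv : ∀ x ∈ W, x * h⁻¹ ∈ W)
    (hsparse : ∀ x ∈ A, x * h ∈ A → x * h⁻¹ ∉ A) : 3 * A.ncard ≤ 2 * W.ncard := by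
  have hmulA : (· * h) '' A ⊆ W := Set.image_subset_iff.2 fun x hx ↦ hmul x (hA hx)
  have hinvA : (· * h⁻¹) '' A ⊆ W := Set.image_subset_iff.2 fun x hx ↦ hinv x (hA hx)
  have hempty : A ∩ (· * h) '' A ∩ (· * h⁻¹) '' A = ∅ := by
    refine Set.eq_empty_of_forall_notMem ?_
    rintro _ ⟨⟨hy, x, hx, rfl⟩, z, hz, hzx⟩
    refine hsparse _ hy ?_ (by simpa using hx)
    rwa [← hzx, inv_mul_cancel_right]
  have hsum := ncard_add_ncard_add_ncard_le hW hA hmulA hinvA hempty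
  rw [Set.ncard_image_of_injective _ (mul_left_injective h),
    Set.ncard_image_of_injective _ (mul_left_injective h⁻¹)] at hsum
  omega

end Counting

section LinearAlgebra

section CommRing

variable {R : Type*} [CommRing R]

theorem smul_smul_eq_trace_smul_sub_det_smul (g : GL (Fin 2) R) (v : Fin 2 → R) :
    g • g • v = g.val.trace • g • v - g.val.det • v := by
  change g.val *ᵥ (g.val *ᵥ v) = g.val.trace • (g.val *ᵥ v) - g.val.det • v
  ext i
  fin_cases i <;>
  · simp only [mulVec, dotProduct, Fin.sum_univ_two, trace_fin_two, det_fin_two, Pi.sub_apply,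
      Pi.smul_apply, smul_eq_mul, Fin.zero_eta, Fin.mk_one]
    ring

theorem trace_mul_add_trace_mul_inv (g h : GL (Fin 2) R) (hh : h.val.det = 1) :
    (g * h).val.trace + (g * h⁻¹).val.trace = g.val.trace * h.val.trace := by
  have hinv : (h⁻¹).val = h.val.adjugate := by
    rw [coe_units_inv, inv_def, hh, Ring.inverse_one, one_smul]
  rw [Units.val_mul, Units.val_mul, hinv, adjugate_fin_two]
  simp only [trace_fin_two, mul_apply, Fin.sum_univ_two, of_apply, cons_val', cons_val_zero,
    cons_val_one, cons_val_fin_one]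
  ring

theorem smul_smul_eq_of_trace_mul_eq {x u : GL (Fin 2) R} {v : Fin 2 → R}
    (htr : (x * u).val.trace = x.val.trace) (hdet : u.val.det = 1) (huv : u • v = v) :
    u • x • v = x • v := by
  have hxu := smul_smul_eq_trace_smul_sub_det_smul (x * u) v
  rw [htr, Units.val_mul, det_mul, hdet, mul_one, mul_smul x u v, huv,
    ← smul_smul_eq_trace_smul_sub_det_smul, mul_smul] at hxu
  exact smul_left_cancel x hxu

end CommRing

variable {K : Type*} [Field K]

theorem hasEigenvalue_one_iff_trace_eq (A : Matrix (Fin 2) (Fin 2) K) :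
    Module.End.HasEigenvalue (toLin' A) 1 ↔ A.trace = 1 + A.det := by
  rw [Module.End.hasEigenvalue_iff_isRoot_charpoly, charpoly_toLin', charpoly_fin_two,
    Polynomial.IsRoot.def]
  simp only [Polynomial.eval_add, Polynomial.eval_sub, Polynomial.eval_pow, Polynomial.eval_X,
    Polynomial.eval_mul, Polynomial.eval_C]
  constructor <;> intro h <;> linear_combination -h

variable {g h u : GL (Fin 2) K} {v w y : Fin 2 → K}

theorem sq_add_det_eq_trace_mul {a : K} (hv : v ≠ 0) (hg : g • v = a • v) :
    a ^ 2 + g.val.det = g.val.trace * a := by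
  have hcayley := smul_smul_eq_trace_smul_sub_det_smul g v
  rw [hg, smul_comm g a v, hg, smul_smul, smul_smul, ← sub_smul] at hcayley
  linear_combination smul_left_injective K hv hcayley

theorem trace_eq_two_of_smul_eq_self (hv : v ≠ 0) (huv : u • v = v) (hdet : u.val.det = 1) :
    u.val.trace = 2 := by
  have h := sq_add_det_eq_trace_mul (a := 1) hv (by rw [huv, one_smul])
  linear_combination hdet - h

theorem smul_eq_self_of_trace_eq_two {a : K} (hv : v ≠ 0) (huv : u • v = a • v)
    (htr : u.val.trace = 2) (hdet : u.val.det = 1) : u • v = v := by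
  have h := sq_add_det_eq_trace_mul hv huv
  rw [htr, hdet] at h
  have ha : a = 1 := sub_eq_zero.1 (pow_eq_zero_iff two_ne_zero |>.1 (by linear_combination h))
  rw [huv, ha, one_smul]

theorem eq_of_smul_eq_of_linearIndependent (hvw : LinearIndependent K ![v, w])
    (hv : g • v = h • v) (hw : g • w = h • w) : g = h := by
  have hspan := hvw.span_eq_top_of_card_eq_finrank (by simp)
  refine Units.ext (toLin'.injective (LinearMap.ext_on_range hspan fun i ↦ ?_))
  fin_cases i
  exacts [hv, hw]

theorem exists_smul_eq_of_smul_eq_self (hu : u ≠ 1) (hv : v ≠ 0) (huv : u • v = v)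
    (huy : u • y = y) : ∃ a : K, a • v = y := by
  by_contra! hne
  exact hu (eq_of_smul_eq_of_linearIndependent ((LinearIndependent.pair_iff' hv).2 hne)
    (by rw [huv, one_smul]) (by rw [huy, one_smul]))

theorem exists_smul_eq_add (hv : v ≠ 0) (huv : u • v = v) (hdet : u.val.det = 1)
    (y : Fin 2 → K) : ∃ c : K, u • y = y + c • v := by
  by_cases hu : u = 1
  · exact ⟨0, by rw [hu, one_smul, zero_smul, add_zero]⟩
  have hfix : u • (u • y - y) = u • y - y := by
    rw [smul_sub, smul_smul_eq_trace_smul_sub_det_smul, trace_eq_two_of_smul_eq_self hv huv hdet,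
      hdet, one_smul, two_smul]
    abel
  obtain ⟨c, hc⟩ := exists_smul_eq_of_smul_eq_self hu hv huv hfix
  exact ⟨c, by rw [hc, add_sub_cancel]⟩

theorem smul_mk_eq_mk_iff (hv : v ≠ 0) (hw : w ≠ 0) :
    g • Projectivization.mk K v hv = Projectivization.mk K w hw ↔ ∃ a : K, g • v = a • w := by
  rw [Projectivization.smul_mk, Projectivization.mk_eq_mk_iff']
  simp only [eq_comm]

theorem linearIndependent_of_mk_ne (hv : v ≠ 0) (hw : w ≠ 0)
    (h : Projectivization.mk K v hv ≠ Projectivization.mk K w hw) :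
    LinearIndependent K ![v, w] := by
  refine (LinearIndependent.pair_iff' hv).2 fun a ha ↦ h.symm ?_
  exact (Projectivization.mk_eq_mk_iff' K w v hw hv).2 ⟨a, ha⟩

end LinearAlgebra

section Borel

/-- The set of elements of `G` that have `1` as an eigenvalue: `G ∩ eigOneSet ℓ` over an arbitrary
commutative ring and in arbitrary size. -/
def eigOneElems {n R : Type*} [Fintype n] [DecidableEq n] [CommRing R] (G : Subgroup (GL n R)) :
    Set (GL n R) :=
  (G : Set (GL n R)) ∩ {γ | Module.End.HasEigenvalue (toLin' γ.val) 1}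

/-- The elements of determinant `1` of a matrix group, as a subgroup of the ambient group. -/
def specialPart {n R : Type*} [Fintype n] [DecidableEq n] [CommRing R] (G : Subgroup (GL n R)) :
    Subgroup (GL n R) :=
  G ⊓ GeneralLinearGroup.det.ker

/-- The matrices acting on the vector `v` through their determinant. In dimension two these are
the matrices fixing the line of `v` and acting trivially on the quotient by that line. -/
def detStabilizer {n R : Type*} [Fintype n] [DecidableEq n] [CommRing R] (v : n → R) :
    Subgroup (GL n R) where
  carrier := {g | g • v = g.val.det • v}
  mul_mem' {g h} hg hh := by
    change g • v = g.val.det • v at hg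
    change h • v = h.val.det • v at hh
    change (g * h) • v = (g * h).val.det • v
    rw [mul_smul, hh, smul_comm, hg, smul_smul, Units.val_mul, det_mul, mul_comm]
  one_mem' := by simp
  inv_mem' {g} hg := by
    change g • v = g.val.det • v at hg
    change g⁻¹ • v = g⁻¹.val.det • v
    rw [inv_smul_eq_iff, smul_comm, hg, smul_smul, ← det_mul, ← Units.val_mul, inv_mul_cancel,
      Units.val_one, det_one, one_smul]

section CommRing

variable {n R : Type*} [Fintype n] [DecidableEq n] [CommRing R] {G : Subgroup (GL n R)}
  {g h : GL n R} {v : n → R}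

theorem eigOneElems_subset : eigOneElems G ⊆ G :=
  Set.inter_subset_left

theorem mem_detStabilizer : g ∈ detStabilizer v ↔ g • v = g.val.det • v :=
  Iff.rfl

theorem mem_specialPart : g ∈ specialPart G ↔ g ∈ G ∧ g.val.det = 1 := by
  rw [specialPart, Subgroup.mem_inf, MonoidHom.mem_ker, Units.ext_iff]
  rfl

theorem specialPart_le : specialPart G ≤ G :=
  inf_le_left

theorem mul_comm_of_specialPart_eq_bot (hG : specialPart G = ⊥) (hg : g ∈ G) (hh : h ∈ G) :
    g * h = h * g := by
  have hmem : g * h * (h * g)⁻¹ ∈ specialPart G := by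
    refine Subgroup.mem_inf.2 ⟨mul_mem (mul_mem hg hh) (inv_mem (mul_mem hh hg)), ?_⟩
    simp only [MonoidHom.mem_ker, map_mul, map_inv]
    rw [mul_comm, mul_comm (GeneralLinearGroup.det g), inv_mul_cancel]
  rwa [hG, Subgroup.mem_bot, mul_inv_eq_one] at hmem

end CommRing

variable {K : Type*} [Field K] {G : Subgroup (GL (Fin 2) K)} {g : GL (Fin 2) K} {v : Fin 2 → K}

theorem mem_eigOneElems : g ∈ eigOneElems G ↔ g ∈ G ∧ g.val.trace = 1 + g.val.det :=
  and_congr_right' (hasEigenvalue_one_iff_trace_eq g.val)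

theorem mem_stabilizer_mk_iff (hv : v ≠ 0) :
    g ∈ MulAction.stabilizer (GL (Fin 2) K) (Projectivization.mk K v hv) ↔
      ∃ a : K, g • v = a • v :=
  smul_mk_eq_mk_iff hv hv

theorem exists_ne_zero_smul_eq_self (hg : g ∈ eigOneElems G) :
    ∃ v : Fin 2 → K, v ≠ 0 ∧ g • v = v := by
  obtain ⟨v, hv⟩ := hg.2.exists_hasEigenvector
  exact ⟨v, hv.2, hv.apply_eq_smul.trans (one_smul K v)⟩

theorem inf_stabilizer_inf_detStabilizer (hv : v ≠ 0) (G : Subgroup (GL (Fin 2) K)) :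
    G ⊓ MulAction.stabilizer _ v ⊓ (G ⊓ detStabilizer v) =
      specialPart G ⊓ MulAction.stabilizer _ v := by
  ext g
  simp only [Subgroup.mem_inf, MulAction.mem_stabilizer_iff, mem_detStabilizer, mem_specialPart]
  constructor
  · rintro ⟨⟨hg, hgv⟩, -, hdet⟩
    refine ⟨⟨hg, smul_left_injective K hv ?_⟩, hgv⟩
    change g.val.det • v = (1 : K) • v
    rw [← hdet, hgv, one_smul]
  · rintro ⟨⟨hg, hdet⟩, hgv⟩
    exact ⟨⟨hg, hgv⟩, hg, by rw [hgv, hdet, one_smul]⟩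

theorem eigOneElems_eq_union (hv : v ≠ 0)
    (hG : G ≤ MulAction.stabilizer (GL (Fin 2) K) (Projectivization.mk K v hv)) :
    eigOneElems G = ((G ⊓ MulAction.stabilizer _ v : Subgroup _) ∪
      (G ⊓ detStabilizer v : Subgroup _) : Set (GL (Fin 2) K)) := by
  ext g
  simp only [Set.mem_union, SetLike.mem_coe, Subgroup.mem_inf, mem_eigOneElems, ← and_or_left,
    MulAction.mem_stabilizer_iff, mem_detStabilizer]
  refine and_congr_right fun hg ↦ ?_
  obtain ⟨a, ha⟩ := (mem_stabilizer_mk_iff hv).1 (hG hg)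
  have hchar := sq_add_det_eq_trace_mul hv ha
  have ha₀ : a ≠ 0 := by
    rintro rfl
    exact hv ((smul_eq_zero_iff_eq g).1 (ha.trans (zero_smul K v)))
  have hfix (b : K) : g • v = b • v ↔ a = b := by
    rw [ha]
    exact (smul_left_injective K hv).eq_iff
  have hfix₁ : g • v = v ↔ a = 1 := by rw [← hfix, one_smul]
  have hfactor : (a - 1) * (a - g.val.det) = a * (g.val.trace - (1 + g.val.det)) := by
    linear_combination hchar
  rw [hfix₁, hfix, ← sub_eq_zero (b := (1 : K)), ← sub_eq_zero (a := a) (b := g.val.det),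
    ← mul_eq_zero, hfactor, mul_eq_zero_iff_left ha₀, sub_eq_zero]

theorem inf_stabilizer_lt (hv : v ≠ 0)
    (hG : G ≤ MulAction.stabilizer (GL (Fin 2) K) (Projectivization.mk K v hv))
    (hX : eigOneElems G ≠ G) : G ⊓ MulAction.stabilizer _ v < G := by
  refine inf_le_left.lt_of_ne fun h ↦ hX ?_
  rw [eigOneElems_eq_union hv hG, h]
  exact Set.union_eq_left.2 inf_le_left

theorem inf_detStabilizer_lt (hv : v ≠ 0)
    (hG : G ≤ MulAction.stabilizer (GL (Fin 2) K) (Projectivization.mk K v hv))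
    (hX : eigOneElems G ≠ G) : G ⊓ detStabilizer v < G := by
  refine inf_le_left.lt_of_ne fun h ↦ hX ?_
  rw [eigOneElems_eq_union hv hG, h]
  exact Set.union_eq_right.2 inf_le_left

theorem four_mul_ncard_eigOneElems_le_of_le_stabilizer [Finite G] (hv : v ≠ 0)
    (hG : G ≤ MulAction.stabilizer (GL (Fin 2) K) (Projectivization.mk K v hv))
    (hX : eigOneElems G ≠ G) : 4 * (eigOneElems G).ncard ≤ 3 * Nat.card G := by
  rw [eigOneElems_eq_union hv hG]
  exact four_mul_ncard_union_le (inf_stabilizer_lt hv hG hX) (inf_detStabilizer_lt hv hG hX)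

theorem two_mul_ncard_eigOneElems_le_of_le_stabilizer [Finite G] (hv : v ≠ 0)
    (hG : G ≤ MulAction.stabilizer (GL (Fin 2) K) (Projectivization.mk K v hv))
    (hX : eigOneElems G ≠ G) :
    2 * (eigOneElems G).ncard ≤ Nat.card G +
      2 * Nat.card (specialPart G ⊓ MulAction.stabilizer _ v : Subgroup (GL (Fin 2) K)) := by
  rw [eigOneElems_eq_union hv hG, ← inf_stabilizer_inf_detStabilizer hv]
  exact two_mul_ncard_union_le (inf_stabilizer_lt hv hG hX) (inf_detStabilizer_lt hv hG hX)

theorem card_specialPart_inf_stabilizer_le [Finite K] (hv : v ≠ 0) (G : Subgroup (GL (Fin 2) K)) :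
    Nat.card (specialPart G ⊓ MulAction.stabilizer _ v : Subgroup (GL (Fin 2) K)) ≤
      Nat.card K := by
  obtain ⟨w, hvw⟩ := exists_linearIndependent_pair_of_one_lt_finrank
    (by simp : 1 < Module.finrank K (Fin 2 → K)) hv
  have hshear (g : (specialPart G ⊓ MulAction.stabilizer _ v : Subgroup (GL (Fin 2) K))) :
      ∃ c : K, g.1 • w = w + c • v :=
    exists_smul_eq_add hv g.2.2 (mem_specialPart.1 g.2.1).2 w
  choose c hc using hshear
  refine Nat.card_le_card_of_injective c fun g h hgh ↦ Subtype.ext ?_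
  exact eq_of_smul_eq_of_linearIndependent hvw (g.2.2.trans h.2.2.symm) (by rw [hc, hc, hgh])

end Borel

section SplitCartanNormalizer

variable {K : Type*} [Field K] {G : Subgroup (GL (Fin 2) K)} {g u : GL (Fin 2) K}
  {v w : Fin 2 → K}

theorem eq_one_of_trace_eq_two {a b : K} (hvw : LinearIndependent K ![v, w])
    (hv : u • v = a • v) (hw : u • w = b • w) (htr : u.val.trace = 2) (hdet : u.val.det = 1) :
    u = 1 := by
  have huv : u • v = v := smul_eq_self_of_trace_eq_two (hvw.ne_zero 0) hv htr hdet
  have huw : u • w = w := smul_eq_self_of_trace_eq_two (hvw.ne_zero 1) hw htr hdet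
  exact eq_of_smul_eq_of_linearIndependent hvw (by rw [huv, one_smul]) (by rw [huw, one_smul])

theorem trace_eq_zero_of_swap {b c : K} (hvw : LinearIndependent K ![v, w])
    (hv : g • v = b • w) (hw : g • w = c • v) : g.val.trace = 0 := by
  have hcayley := smul_smul_eq_trace_smul_sub_det_smul g v
  rw [hv, smul_comm, hw, smul_smul, smul_smul] at hcayley
  have hb : b ≠ 0 := by
    rintro rfl
    exact hvw.ne_zero 0 ((smul_eq_zero_iff_eq g).1 (hv.trans (zero_smul K w)))
  have hcoeff := LinearIndependent.pair_iff.1 hvw (b * c + g.val.det) (-(g.val.trace * b))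
    (by rw [add_smul, hcayley]; module)
  exact (mul_eq_zero_iff_right hb).1 (neg_eq_zero.1 hcoeff.2)

theorem eigOneElems_inter_specialPart_subset {L L' : ℙ K (Fin 2 → K)} (hne : L ≠ L')
    (hL : G ≤ MulAction.stabilizer (GL (Fin 2) K) L)
    (hL' : G ≤ MulAction.stabilizer (GL (Fin 2) K) L') :
    eigOneElems G ∩ specialPart G ⊆ {1} := by
  rintro u ⟨hu, hu'⟩
  obtain ⟨huG, hdet⟩ := mem_specialPart.1 hu'
  have htr : u.val.trace = 2 := by
    rw [(mem_eigOneElems.1 hu).2, hdet, one_add_one_eq_two]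
  induction L with | h v hv =>
  induction L' with | h w hw =>
  obtain ⟨a, ha⟩ := (mem_stabilizer_mk_iff hv).1 (hL huG)
  obtain ⟨b, hb⟩ := (mem_stabilizer_mk_iff hw).1 (hL' huG)
  exact eq_one_of_trace_eq_two (linearIndependent_of_mk_ne hv hw hne) ha hb htr hdet

theorem det_eq_neg_one_of_swap {L L' : ℙ K (Fin 2 → K)} (hne : L ≠ L') (hg : g ∈ eigOneElems G)
    (hL : g • L = L') (hL' : g • L' = L) : g.val.det = -1 := by
  induction L with | h v hv =>
  induction L' with | h w hw =>
  obtain ⟨b, hb⟩ := (smul_mk_eq_mk_iff hv hw).1 hL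
  obtain ⟨c, hc⟩ := (smul_mk_eq_mk_iff hw hv).1 hL'
  have htr : g.val.trace = 0 := trace_eq_zero_of_swap (linearIndependent_of_mk_ne hv hw hne) hb hc
  linear_combination htr - (mem_eigOneElems.1 hg).2

theorem ncard_eigOneElems_add_card_specialPart_le [Finite G] {L L' : ℙ K (Fin 2 → K)}
    (hne : L ≠ L') (hL : G ≤ MulAction.stabilizer (GL (Fin 2) K) L)
    (hL' : G ≤ MulAction.stabilizer (GL (Fin 2) K) L') :
    (eigOneElems G).ncard + Nat.card (specialPart G) ≤ Nat.card G + 1 :=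
  calc (eigOneElems G).ncard + Nat.card (specialPart G)
      ≤ Nat.card G + (eigOneElems G ∩ specialPart G).ncard :=
        ncard_add_ncard_le (G : Set (GL (Fin 2) K)).toFinite eigOneElems_subset specialPart_le
    _ ≤ Nat.card G + 1 := by
        gcongr
        exact (Set.ncard_le_ncard (eigOneElems_inter_specialPart_subset hne hL hL')).trans
          (Set.ncard_singleton 1).le

theorem ncard_eigOneElems_sdiff_stabilizer_le [Finite G] {L L' : ℙ K (Fin 2 → K)} (hne : L ≠ L')
    (hswap : ∀ g ∈ G, g • L ≠ L → g • L = L' ∧ g • L' = L) :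
    (eigOneElems G \ MulAction.stabilizer (GL (Fin 2) K) L).ncard ≤
      Nat.card (specialPart (G ⊓ MulAction.stabilizer (GL (Fin 2) K) L)) := by
  have : Finite (specialPart (G ⊓ MulAction.stabilizer (GL (Fin 2) K) L)) :=
    (G : Set (GL (Fin 2) K)).toFinite.subset (specialPart_le.trans inf_le_left)
  refine ncard_le_card_of_mul_mem fun x ⟨hx, hxL⟩ y ⟨hy, hyL⟩ ↦ ?_
  obtain ⟨hxL, hxL'⟩ := hswap x hx.1 hxL
  obtain ⟨hyL, hyL'⟩ := hswap y hy.1 hyL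
  refine mem_specialPart.2 ⟨⟨mul_mem hx.1 hy.1, ?_⟩, ?_⟩
  · exact (mul_smul x y L).trans (by rw [hyL, hxL'])
  · rw [Units.val_mul, det_mul, det_eq_neg_one_of_swap hne hx hxL hxL',
      det_eq_neg_one_of_swap hne hy hyL hyL', neg_one_mul, neg_neg]

theorem two_mul_ncard_eigOneElems_le_of_fixes_two [Finite G] {L L' : ℙ K (Fin 2 → K)}
    (hne : L ≠ L') (hL : G ≤ MulAction.stabilizer (GL (Fin 2) K) L)
    (hL' : G ≤ MulAction.stabilizer (GL (Fin 2) K) L') (hX : eigOneElems G ≠ G) :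
    2 * (eigOneElems G).ncard ≤ Nat.card G + 2 := by
  have hspecial := eigOneElems_inter_specialPart_subset hne hL hL'
  induction L with | h v hv =>
  have hbot : specialPart G ⊓ MulAction.stabilizer _ v = ⊥ := by
    refine (Subgroup.eq_bot_iff_forall _).2 fun u ⟨hu, huv⟩ ↦ hspecial ⟨?_, hu⟩
    obtain ⟨huG, hdet⟩ := mem_specialPart.1 hu
    exact mem_eigOneElems.2 ⟨huG, by
      rw [trace_eq_two_of_smul_eq_self hv huv hdet, hdet, one_add_one_eq_two]⟩
  simpa only [hbot, Subgroup.card_bot] using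
    two_mul_ncard_eigOneElems_le_of_le_stabilizer hv hL hX

theorem two_mul_ncard_eigOneElems_le_of_permutes_pair [Finite G] {L L' : ℙ K (Fin 2 → K)}
    (hne : L ≠ L') (hG : ∀ g ∈ G, s(g • L, g • L') = s(L, L')) (hX : eigOneElems G ≠ G) :
    2 * (eigOneElems G).ncard ≤ Nat.card G + 2 := by
  have hfix : G ⊓ MulAction.stabilizer (GL (Fin 2) K) L ≤ MulAction.stabilizer _ L' := by
    rintro g ⟨hg, hgL : g • L = L⟩
    have := hG g hg
    rw [hgL, Sym2.congr_right] at this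
    exact this
  by_cases hL : G ≤ MulAction.stabilizer (GL (Fin 2) K) L
  · exact two_mul_ncard_eigOneElems_le_of_fixes_two hne hL ((le_inf le_rfl hL).trans hfix) hX
  have hswap : ∀ g ∈ G, g • L ≠ L → g • L = L' ∧ g • L' = L := fun g hg hgL ↦
    (Sym2.eq_iff.1 (hG g hg)).resolve_left fun h ↦ hgL h.1
  have hindex := two_mul_card_le_of_lt (inf_lt_left.2 hL)
  have : Finite (G ⊓ MulAction.stabilizer (GL (Fin 2) K) L : Subgroup _) :=
    (G : Set (GL (Fin 2) K)).toFinite.subset inf_le_left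
  have hin := ncard_eigOneElems_add_card_specialPart_le hne inf_le_right hfix
  have hout := ncard_eigOneElems_sdiff_stabilizer_le hne hswap
  have hsplit : (eigOneElems G).ncard =
      (eigOneElems (G ⊓ MulAction.stabilizer (GL (Fin 2) K) L)).ncard +
        (eigOneElems G \ MulAction.stabilizer (GL (Fin 2) K) L).ncard := by
    rw [← Set.ncard_inter_add_ncard_sdiff_eq_ncard (eigOneElems G)
      (MulAction.stabilizer (GL (Fin 2) K) L)
      ((G : Set (GL (Fin 2) K)).toFinite.subset eigOneElems_subset), eigOneElems, eigOneElems,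
      Set.inter_right_comm, Subgroup.coe_inf]
  omega

end SplitCartanNormalizer

section ThreeQuarters

variable {K : Type*} [Field K] {G : Subgroup (GL (Fin 2) K)} {h u x : GL (Fin 2) K}
  {v : Fin 2 → K}

theorem four_mul_ncard_le_of_eigOneElems_subset [Finite G] (hsub : eigOneElems G ⊆ {1})
    (hX : eigOneElems G ≠ G) : 4 * (eigOneElems G).ncard ≤ 3 * Nat.card G := by
  have hcard : (eigOneElems G).ncard < Nat.card G :=
    Set.ncard_lt_ncard (eigOneElems_subset.ssubset_of_ne hX) (G : Set (GL (Fin 2) K)).toFinite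
  have := Set.ncard_le_ncard hsub
  rw [Set.ncard_singleton] at this
  omega

theorem four_mul_ncard_le_of_specialPart_eq_bot [Finite G] (hG : specialPart G = ⊥)
    (hX : eigOneElems G ≠ G) : 4 * (eigOneElems G).ncard ≤ 3 * Nat.card G := by
  by_cases hsub : eigOneElems G ⊆ {1}
  · exact four_mul_ncard_le_of_eigOneElems_subset hsub hX
  obtain ⟨x, hx, hx₁⟩ := Set.not_subset.1 hsub
  obtain ⟨v, hv, hxv⟩ := exists_ne_zero_smul_eq_self hx
  refine four_mul_ncard_eigOneElems_le_of_le_stabilizer hv (fun g hg ↦ ?_) hX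
  have hxg : x • g • v = g • v := by
    rw [← mul_smul, mul_comm_of_specialPart_eq_bot hG hx.1 hg, mul_smul, hxv]
  obtain ⟨a, ha⟩ := exists_smul_eq_of_smul_eq_self hx₁ hv hxv hxg
  exact (mem_stabilizer_mk_iff hv).2 ⟨a, ha.symm⟩

theorem mem_stabilizer_mk_of_mul_mem_eigOneElems (hu : u ≠ 1) (hdet : u.val.det = 1) (hv : v ≠ 0)
    (huv : u • v = v) (hx : x ∈ eigOneElems G) (hxu : x * u ∈ eigOneElems G) :
    x ∈ MulAction.stabilizer (GL (Fin 2) K) (Projectivization.mk K v hv) := by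
  have htr : (x * u).val.trace = x.val.trace := by
    rw [(mem_eigOneElems.1 hxu).2, (mem_eigOneElems.1 hx).2, Units.val_mul, det_mul, hdet, mul_one]
  obtain ⟨a, ha⟩ := exists_smul_eq_of_smul_eq_self hu hv huv
    (smul_smul_eq_of_trace_mul_eq htr hdet huv)
  exact (mem_stabilizer_mk_iff hv).2 ⟨a, ha.symm⟩

theorem four_mul_ncard_le_of_exists_unipotent [Finite G] (hu : u ∈ specialPart G)
    (hu₁ : u ≠ 1) (huX : u ∈ eigOneElems G) (hX : eigOneElems G ≠ G) :
    4 * (eigOneElems G).ncard ≤ 3 * Nat.card G := by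
  obtain ⟨huG, hdet⟩ := mem_specialPart.1 hu
  obtain ⟨v, hv, huv⟩ := exists_ne_zero_smul_eq_self huX
  by_cases hG : G ≤ MulAction.stabilizer (GL (Fin 2) K) (Projectivization.mk K v hv)
  · exact four_mul_ncard_eigOneElems_le_of_le_stabilizer hv hG hX
  have hfin : (G : Set (GL (Fin 2) K)).Finite := Set.toFinite _
  have hshift : (· * u⁻¹) '' eigOneElems G ⊆ G := by
    rintro _ ⟨x, hx, rfl⟩
    exact mul_mem hx.1 (inv_mem huG)
  have hinter : eigOneElems G ∩ (· * u⁻¹) '' eigOneElems G ⊆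
      (G ⊓ MulAction.stabilizer _ (Projectivization.mk K v hv) : Subgroup (GL (Fin 2) K)) := by
    rintro x ⟨hx, y, hy, rfl⟩
    exact ⟨hx.1, mem_stabilizer_mk_of_mul_mem_eigOneElems hu₁ hdet hv huv hx
      (by rwa [inv_mul_cancel_right])⟩
  have hcount := (ncard_add_ncard_le hfin eigOneElems_subset hshift).trans
    (Nat.add_le_add_left (Set.ncard_le_ncard hinter (hfin.subset inf_le_left)) _)
  rw [Set.ncard_image_of_injective _ (mul_left_injective u⁻¹)] at hcount
  have hindex := two_mul_card_le_of_lt (inf_lt_left.2 hG)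
  change _ ≤ Nat.card G + Nat.card (G ⊓ MulAction.stabilizer _ _ : Subgroup _) at hcount
  omega

theorem det_eq_neg_one_of_mul_mem_eigOneElems (hh : h.val.det = 1) (htr : h.val.trace ≠ 2)
    (hx : x ∈ eigOneElems G) (hxh : x * h ∈ eigOneElems G) (hxh' : x * h⁻¹ ∈ eigOneElems G) :
    x.val.det = -1 := by
  have hinv : (h⁻¹).val.det = 1 := by
    rw [coe_units_inv, det_nonsing_inv, hh, Ring.inverse_one]
  have hsum := trace_mul_add_trace_mul_inv x h hh
  rw [(mem_eigOneElems.1 hx).2, (mem_eigOneElems.1 hxh).2, (mem_eigOneElems.1 hxh').2,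
    Units.val_mul, Units.val_mul, det_mul, det_mul, hh, hinv] at hsum
  have hprod : (h.val.trace - 2) * (1 + x.val.det) = 0 := by linear_combination -hsum
  have := (mul_eq_zero_iff_left (sub_ne_zero.2 htr)).1 hprod
  linear_combination this

theorem three_mul_ncard_eigOneElems_sdiff_le [Finite G] (hh : h ∈ specialPart G)
    (htr : h.val.trace ≠ 2) :
    3 * ((eigOneElems G \ specialPart G) \ {g | g.val.det = -1}).ncard ≤
      2 * (((G : Set (GL (Fin 2) K)) \ specialPart G) \ {g | g.val.det = -1}).ncard := by
  have hmul : ∀ y ∈ specialPart G,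
      ∀ x ∈ ((G : Set (GL (Fin 2) K)) \ specialPart G) \ {g | g.val.det = -1},
        x * y ∈ ((G : Set (GL (Fin 2) K)) \ specialPart G) \ {g | g.val.det = -1} := by
    rintro y hy x ⟨⟨hx, hxS⟩, hxD⟩
    refine ⟨⟨mul_mem hx (specialPart_le hy), fun h ↦ hxS ((mul_mem_cancel_right hy).1 h)⟩, ?_⟩
    change (x * y).val.det ≠ -1
    rwa [Units.val_mul, det_mul, (mem_specialPart.1 hy).2, mul_one]
  refine three_mul_ncard_le_two_mul_ncard ((G : Set (GL (Fin 2) K)).toFinite.sdiff.sdiff)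
    (by gcongr; exact eigOneElems_subset) h (hmul h hh) (hmul h⁻¹ (inv_mem hh)) ?_
  exact fun x hx hxh hxh' ↦ hx.2
    (det_eq_neg_one_of_mul_mem_eigOneElems (mem_specialPart.1 hh).2 htr hx.1.1 hxh.1.1 hxh'.1.1)

theorem ncard_det_eq_neg_one_le [Finite G] :
    (((G : Set (GL (Fin 2) K)) \ specialPart G) ∩ {g | g.val.det = -1}).ncard ≤
      Nat.card (specialPart G) := by
  have : Finite (specialPart G) := (G : Set (GL (Fin 2) K)).toFinite.subset specialPart_le
  refine ncard_le_card_of_mul_mem ?_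
  rintro x ⟨⟨hx, -⟩, hxdet : x.val.det = -1⟩ y ⟨⟨hy, -⟩, hydet : y.val.det = -1⟩
  refine mem_specialPart.2 ⟨mul_mem hx hy, ?_⟩
  rw [Units.val_mul, det_mul, hxdet, hydet, neg_one_mul, neg_neg]

theorem four_mul_ncard_le_of_no_unipotent [Finite G] (hG : specialPart G ≠ ⊥)
    (hS : eigOneElems G ∩ specialPart G ⊆ {1}) :
    4 * (eigOneElems G).ncard ≤ 3 * Nat.card G := by
  have hfin : (G : Set (GL (Fin 2) K)).Finite := Set.toFinite _
  have : Finite (specialPart G) := hfin.subset specialPart_le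
  obtain ⟨h, hh, hh₁⟩ := (specialPart G).bot_or_exists_ne_one.resolve_left hG
  have htr : h.val.trace ≠ 2 := fun htr ↦ hh₁ <| hS ⟨mem_eigOneElems.2 ⟨specialPart_le hh, by
    rw [htr, (mem_specialPart.1 hh).2, one_add_one_eq_two]⟩, hh⟩
  have hX := ncard_eq_inter_add_inter_add_sdiff (hfin.subset eigOneElems_subset) (specialPart G)
    {g | g.val.det = -1}
  have hcard : Nat.card G = _ :=
    ncard_eq_inter_add_inter_add_sdiff hfin (specialPart G) {g | g.val.det = -1}
  have hXS : (eigOneElems G ∩ specialPart G).ncard ≤ 1 :=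
    (Set.ncard_le_ncard hS).trans (Set.ncard_singleton 1).le
  have hGS : (G ∩ specialPart G : Set (GL (Fin 2) K)).ncard = Nat.card (specialPart G) := by
    rw [Set.inter_eq_right.2 specialPart_le]
    rfl
  have hXD : ((eigOneElems G \ specialPart G) ∩ {g | g.val.det = -1}).ncard ≤
      (((G : Set (GL (Fin 2) K)) \ specialPart G) ∩ {g | g.val.det = -1}).ncard :=
    Set.ncard_le_ncard (by gcongr; exact eigOneElems_subset) (hfin.sdiff.inter_of_left _)
  have hD := ncard_det_eq_neg_one_le (G := G)
  have hW := three_mul_ncard_eigOneElems_sdiff_le hh htr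
  have hcardS : 1 < Nat.card (specialPart G) := (Subgroup.one_lt_card_iff_ne_bot _).2 hG
  omega

theorem four_mul_ncard_eigOneElems_le [Finite G] (hX : eigOneElems G ≠ G) :
    4 * (eigOneElems G).ncard ≤ 3 * Nat.card G := by
  by_cases hG : specialPart G = ⊥
  · exact four_mul_ncard_le_of_specialPart_eq_bot hG hX
  by_cases hS : eigOneElems G ∩ specialPart G ⊆ {1}
  · exact four_mul_ncard_le_of_no_unipotent hG hS
  · obtain ⟨u, ⟨huX, hu⟩, hu₁⟩ := Set.not_subset.1 hS
    exact four_mul_ncard_le_of_exists_unipotent hu hu₁ huX hX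

end ThreeQuarters

section Proportion

/-- `F1` for a matrix group of arbitrary size over an arbitrary commutative ring; it is `0` for an
infinite group. -/
noncomputable def eigOneProportion {n R : Type*} [Fintype n] [DecidableEq n] [CommRing R]
    (G : Subgroup (GL n R)) : ℚ :=
  (eigOneElems G).ncard / Nat.card G

section CommRing

variable {n R : Type*} [Fintype n] [DecidableEq n] [CommRing R] {G : Subgroup (GL n R)} [Finite G]

theorem eigOneElems_ne_of_eigOneProportion_ne_one (h : eigOneProportion G ≠ 1) :
    eigOneElems G ≠ G := by
  intro hG
  rw [eigOneProportion, hG] at h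
  exact h (div_self (Nat.cast_ne_zero.2 Nat.card_pos.ne'))

theorem eigOneProportion_le_half_add {c : ℕ}
    (h : 2 * (eigOneElems G).ncard ≤ Nat.card G + 2 * c) :
    eigOneProportion G ≤ 1 / 2 + c / Nat.card G := by
  have hG : (0 : ℚ) < Nat.card G := Nat.cast_pos.2 Nat.card_pos
  rw [eigOneProportion, div_add_div _ _ two_ne_zero hG.ne', div_le_div_iff₀ hG (by positivity)]
  have : (2 * (eigOneElems G).ncard : ℚ) ≤ Nat.card G + 2 * c := mod_cast h
  nlinarith

theorem eigOneProportion_le_three_quarters (h : 4 * (eigOneElems G).ncard ≤ 3 * Nat.card G) :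
    eigOneProportion G ≤ 3 / 4 := by
  have hG : (0 : ℚ) < Nat.card G := Nat.cast_pos.2 Nat.card_pos
  rw [eigOneProportion, div_le_div_iff₀ hG four_pos, mul_comm]
  exact mod_cast h

end CommRing

end Proportion

section StandardSubgroups

theorem ConjInto.splitCartanNormalizer {ℓ : ℕ} {G : Subgroup (GL2 ℓ)}
    (h : ConjInto G (splitCartan ℓ)) : ConjInto G (splitCartanNormalizer ℓ) :=
  h.imp fun _ hγ ↦ hγ.trans fun _ ↦ Or.inl

variable {ℓ : ℕ} [Fact ℓ.Prime] {G : Subgroup (GL2 ℓ)}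

/-- The coordinate axis spanned by the `i`-th standard basis vector, as a point of the projective
line. -/
def axis (ℓ : ℕ) [Fact ℓ.Prime] (i : Fin 2) : ℙ (ZMod ℓ) (Fin 2 → ZMod ℓ) :=
  Projectivization.mk _ (Pi.single i 1) (by simp)

theorem axis_zero_ne_axis_one : axis ℓ 0 ≠ axis ℓ 1 := by
  rw [axis, axis, Ne, Projectivization.mk_eq_mk_iff']
  rintro ⟨a, ha⟩
  simpa using congrFun ha 0

theorem smul_axis_eq_axis {g : GL2 ℓ} {i j : Fin 2} {a : ZMod ℓ}
    (h : g.val.col i = Pi.single j a) : g • axis ℓ i = axis ℓ j := by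
  refine (smul_mk_eq_mk_iff _ _).2 ⟨a, ?_⟩
  change g.val *ᵥ Pi.single i 1 = a • Pi.single j 1
  rw [mulVec_single_one, h, ← Pi.single_smul, smul_eq_mul, mul_one]

theorem smul_axis_zero_of_mem_borel {g : GL2 ℓ} (hg : g ∈ borel ℓ) : g • axis ℓ 0 = axis ℓ 0 := by
  obtain ⟨a, b, d, hg⟩ := hg
  refine smul_axis_eq_axis (a := a) ?_
  ext i
  fin_cases i <;> simp [hg]

theorem smul_axes_of_mem_splitCartanNormalizer {g : GL2 ℓ} (hg : g ∈ splitCartanNormalizer ℓ) :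
    s(g • axis ℓ 0, g • axis ℓ 1) = s(axis ℓ 0, axis ℓ 1) := by
  obtain ⟨a, d, hg⟩ | ⟨b, c, hg⟩ := hg
  · have h₀ : g • axis ℓ 0 = axis ℓ 0 :=
      smul_axis_eq_axis (a := a) (by ext i; fin_cases i <;> simp [hg])
    have h₁ : g • axis ℓ 1 = axis ℓ 1 :=
      smul_axis_eq_axis (a := d) (by ext i; fin_cases i <;> simp [hg])
    rw [h₀, h₁]
  · have h₀ : g • axis ℓ 0 = axis ℓ 1 :=
      smul_axis_eq_axis (a := c) (by ext i; fin_cases i <;> simp [hg])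
    have h₁ : g • axis ℓ 1 = axis ℓ 0 :=
      smul_axis_eq_axis (a := b) (by ext i; fin_cases i <;> simp [hg])
    rw [h₀, h₁, Sym2.eq_swap]

theorem exists_fixed_line_of_conjInto_borel (h : ConjInto G (borel ℓ)) :
    ∃ L : ℙ (ZMod ℓ) (Fin 2 → ZMod ℓ), ∀ g ∈ G, g • L = L := by
  obtain ⟨γ, hγ⟩ := h
  refine ⟨γ⁻¹ • axis ℓ 0, fun g hg ↦ ?_⟩
  have hfix : (γ * g * γ⁻¹) • axis ℓ 0 = axis ℓ 0 :=
    smul_axis_zero_of_mem_borel (hγ (Subgroup.mem_map_of_mem _ hg))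
  rwa [mul_smul, mul_smul, ← eq_inv_smul_iff] at hfix

theorem exists_line_pair_of_conjInto_splitCartanNormalizer
    (h : ConjInto G (splitCartanNormalizer ℓ)) :
    ∃ L L' : ℙ (ZMod ℓ) (Fin 2 → ZMod ℓ),
      L ≠ L' ∧ ∀ g ∈ G, s(g • L, g • L') = s(L, L') := by
  obtain ⟨γ, hγ⟩ := h
  refine ⟨γ⁻¹ • axis ℓ 0, γ⁻¹ • axis ℓ 1,
    (MulAction.injective γ⁻¹).ne axis_zero_ne_axis_one, fun g hg ↦ ?_⟩
  have hfix : s((γ * g * γ⁻¹) • axis ℓ 0, (γ * g * γ⁻¹) • axis ℓ 1) = s(axis ℓ 0, axis ℓ 1) :=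
    smul_axes_of_mem_splitCartanNormalizer (hγ (Subgroup.mem_map_of_mem _ hg))
  simpa only [Sym2.map_mk, smul_smul, mul_assoc, inv_mul_cancel_left] using
    congrArg (Sym2.map (γ⁻¹ • ·)) hfix

end StandardSubgroups

end EigOne

theorem mainTheorem4_general {K : Type*} [Field K]
    (G : Subgroup (Matrix.GeneralLinearGroup (Fin 2) K)) [Finite G]
    (hG : EigOne.eigOneProportion G ≠ 1) :
    ((∃ L L' : Projectivization K (Fin 2 → K),
        L ≠ L' ∧ ∀ g ∈ G, s(g • L, g • L') = s(L, L')) →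
      EigOne.eigOneProportion G ≤ 1 / 2 + 1 / (Nat.card G : ℚ)) ∧
    (Finite K → (∃ L : Projectivization K (Fin 2 → K), ∀ g ∈ G, g • L = L) →
      EigOne.eigOneProportion G ≤ 1 / 2 + (Nat.card K : ℚ) / (Nat.card G : ℚ)) ∧
    EigOne.eigOneProportion G ≤ 3 / 4 := by
  have hX := EigOne.eigOneElems_ne_of_eigOneProportion_ne_one hG
  refine ⟨?_, ?_,
    EigOne.eigOneProportion_le_three_quarters (EigOne.four_mul_ncard_eigOneElems_le hX)⟩
  · rintro ⟨L, L', hne, hpair⟩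
    simpa only [Nat.cast_one] using EigOne.eigOneProportion_le_half_add (c := 1)
      (EigOne.two_mul_ncard_eigOneElems_le_of_permutes_pair hne hpair hX)
  · rintro _ ⟨L, hL⟩
    induction L with | h v hv =>
    refine EigOne.eigOneProportion_le_half_add
      ((EigOne.two_mul_ncard_eigOneElems_le_of_le_stabilizer hv hL hX).trans ?_)
    gcongr
    exact EigOne.card_specialPart_inf_stabilizer_le hv G

theorem mainTheorem4 (ℓ : ℕ) [Fact ℓ.Prime] (hℓ : Odd ℓ) (G : Subgroup (EigOne.GL2 ℓ))
    (hG : EigOne.F1 G ≠ 1) :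
    (EigOne.IsTypeCs G → EigOne.F1 G ≤ 1 / 2 + 1 / (Nat.card G : ℚ)) ∧
    (∀ ε : ZMod ℓ, ¬ IsSquare ε → EigOne.IsTypeNs ε G →
      EigOne.F1 G ≤ 1 / 2 + 1 / (Nat.card G : ℚ)) ∧
    (EigOne.IsTypeB G → EigOne.F1 G ≤ 1 / 2 + (ℓ : ℚ) / (Nat.card G : ℚ)) ∧
    (EigOne.IsTypeA4 G ∨ EigOne.IsTypeS4 G ∨ EigOne.IsTypeA5 G → EigOne.F1 G ≤ 3 / 4) ∧
    EigOne.F1 G ≤ 3 / 4 := by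
  obtain ⟨hpair, hline, hle⟩ := mainTheorem4_general G hG
  rw [Nat.card_zmod] at hline
  exact ⟨fun h ↦ hpair (EigOne.exists_line_pair_of_conjInto_splitCartanNormalizer
      h.2.splitCartanNormalizer),
    fun _ _ h ↦ hpair (EigOne.exists_line_pair_of_conjInto_splitCartanNormalizer h.2.1),
    fun h ↦ hline inferInstance (EigOne.exists_fixed_line_of_conjInto_borel h.2.1),
    fun _ ↦ hle, hle⟩
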